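/- For positive integers $n,d,k$ and $\beta=1/k$, let $\mathcal D_\beta$ be the distribution of the random matrix $U=VW\in\mathbb R^{n\times d}$, where $V\in\mathbb R^{n\times d/\beta}$ has independent columns, each uniformly distributed among the $n$ canonical basis vectors of $\mathbb R^n$, and where, independently of $V$, the matrix $W\in\mathbb R^{d/\beta\times d}$ has entries $W_{j,i}=\sigma_j\sqrt\beta$ for $(i-1)/\beta<j\le i/\beta$ and $W_{j,i}=0$ otherwise, with independent uniform signs $\sigma_j\in\{-1,1\}$. For an integer $L\ge 1$, let $\widetilde{\mathcal D}$ be the mixture that is $\mathcal D_1$ with probability $1/2$ and, with probability $1/2$, is $\mathcal D_{2^{-\ell}}$ for $\ell$ chosen uniformly from $\{1,\dots,L\}$. A matrix $\Pi\in\mathbb R^{m\times n}$ is an $(\epsilon,\delta)$-subspace-embedding for $U\sim\widetilde{\mathcal D}$ if $$\Pr_{U\sim\widetilde{\mathcal D}}\left[\forall x\in\mathbb R^d:\ (1-\epsilon)\|Ux\|_2\le\|\Pi Ux\|_2\le(1+\epsilon)\|Ux\|_2\right]\ge 1-\delta .$$ The column sparsity of $\Pi$ is the maximum number of nonzero entries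 in a column. **Theorem.** There exist absolute constants $\epsilon_0,\delta_0,c_0,K_0,K_1>0$ such that the following holds. Let $\epsilon\in(0,\epsilon_0)$, $\delta\in(0,\delta_0)$, let $d\ge 1/\epsilon^2$, $1\le s\le 1/(9\epsilon)$, $n\ge K_0d^2/(\epsilon^2\delta)$ and $L\ge 1$ be integers (in particular $L$ may be $\lfloor\log_2(1/\epsilon)\rfloor-3$, $\lfloor \log_2 s\rfloor$ when $s\ge 2$, or $s$), and let $\Pi\in\mathbb R^{m\times n}$. If the column sparsity of $\Pi$ is at most $s$ and $\Pi$ is an $(\epsilon,\delta)$-subspace-embedding for $U\sim\widetilde{\mathcal D}$, then $$m\ \ge\ c_0\,\bigl(\max\{1,\log_2 s\}\bigr)^{-4}\,s^{-K_1\delta}\,d^2 .$$ In particular, for $s\ge 2$, $m=\Omega\bigl((\log_2 s)^{-4}s^{-K_1\delta}d^2\bigr)$. -/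

import Mathlib

noncomputable section

/-- The matrix `V` whose column `j` is the canonical basis vector `e_{c j}`. -/
def basisColumns {n : ℕ} {J : Type*} (c : J → Fin n) : Matrix (Fin n) J ℝ :=
  Matrix.of fun r j => if r = c j then 1 else 0

/-- The matrix `W` with `β = 1 / k`. Its `d / β = d * k` rows are indexed by `Fin d × Fin k`, the
pair `(i, t)` being the `t`-th row of the `i`-th block of `1 / β` consecutive rows. Column `i` has
the entries `σ_j * √β` in the rows `j` of block `i`, and zeros elsewhere. -/
def signedBlocks {d k : ℕ} (σ : Fin d × Fin k → ℤˣ) : Matrix (Fin d × Fin k) (Fin d) ℝ :=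
  Matrix.of fun j i => if j.1 = i then (((σ j : ℤˣ) : ℤ) : ℝ) * Real.sqrt (1 / (k : ℝ)) else 0

/-- The distribution `𝒟_β` on `n × d` matrices for `β = 1 / k`: the law of `U = V * W`, where the
`d * k` columns of `V` are independent uniform canonical basis vectors of `ℝⁿ` and, independently,
the `d * k` signs in `W` are independent uniform in `{-1, 1}`. (Uniform on a finite product is the
same as independent and uniform in every coordinate.) -/
def hardDist (n d k : ℕ) [NeZero n] : PMF (Matrix (Fin n) (Fin d) ℝ) :=
  (PMF.uniformOfFintype ((Fin d × Fin k → Fin n) × (Fin d × Fin k → ℤˣ))).map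
    fun ω => basisColumns ω.1 * signedBlocks ω.2

/-- The distribution `𝒟̃`: with probability `1/2` it is `𝒟_1`, and with probability `1/2` it is
`𝒟_{2^{-ℓ}}` for `ℓ` uniform in `{1, …, L}`. -/
def mixedHardDist (n d L : ℕ) [NeZero n] (hL : 1 ≤ L) : PMF (Matrix (Fin n) (Fin d) ℝ) :=
  (PMF.uniformOfFintype Bool).bind fun b =>
    if b then hardDist n d 1
    else (PMF.uniformOfFinset (Finset.Icc 1 L) (Finset.nonempty_Icc.2 hL)).bind
      fun l => hardDist n d (2 ^ l)

/-- `Π` is a subspace embedding for the column space of `A`, with distortion `ε`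
(Euclidean norms). -/
def EmbedsColumnSpace {m n d : ℕ} (ε : ℝ) (P : Matrix (Fin m) (Fin n) ℝ)
    (A : Matrix (Fin n) (Fin d) ℝ) : Prop :=
  ∀ x : Fin d → ℝ,
    (1 - ε) * ‖WithLp.toLp 2 (A.mulVec x)‖ ≤ ‖WithLp.toLp 2 ((P * A).mulVec x)‖ ∧
      ‖WithLp.toLp 2 ((P * A).mulVec x)‖ ≤ (1 + ε) * ‖WithLp.toLp 2 (A.mulVec x)‖

/-- `Π` is an `(ε, δ)`-subspace-embedding for `A ∼ 𝒟`: the probability over `A ∼ 𝒟` that `Π` is a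
subspace embedding for `A` is at least `1 - δ`. -/
def IsSubspaceEmbedding {m n d : ℕ} (ε δ : ℝ) (P : Matrix (Fin m) (Fin n) ℝ)
    (D : PMF (Matrix (Fin n) (Fin d) ℝ)) : Prop :=
  ENNReal.ofReal (1 - δ) ≤ D.toOuterMeasure {A | EmbedsColumnSpace ε P A}

open Classical in
/-- The column sparsity: the largest number of nonzero entries in a column. -/
def columnSparsity {m n : ℕ} (P : Matrix (Fin m) (Fin n) ℝ) : ℕ :=
  Finset.univ.sup fun j : Fin n => (Finset.univ.filter fun i : Fin m => P i j ≠ 0).card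

end

open scoped BigOperators

/-! The component `𝒟_1` alone forces `m ≥ d² / 200`; the logarithmic factor and the power of `s` in
the bound are at most `1`. Under `𝒟_1` the columns of `U` are signed basis vectors at random
positions, so an embedding makes each sampled column of `P` have norm within `ε` of `1`, and any two
distinct sampled columns have inner product at most `2ε` in absolute value.

Upper bound on correlated pairs: join two columns when their inner product exceeds `2ε`. Two
independent halves of the sample are rarely joined. By the second moment method, vertices of degree
density at least of order `1 / d` are then rare (`expect_hub_le`), and the edges between the other
vertices have density `O(1 / d²)` (`expect_edge_le`).

Lower bound (`le_expect_abs_inner_gt`): let `u_x` be a random column and `f_x` its entries of square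
at least `1 / (2s)`, which carry a constant mass. The average of `⟨f_x, f_y⟩⟨u_x, u_y⟩` is a sum of
squares containing `∑ (𝔼 f_r²)²`, which is at least of order `1 / m`. Pairs with inner product at
most `2ε` account for at most `4/9` of that sum, because `s ≤ 1 / (9ε)`. Hence correlated pairs have
density at least of order `1 / m`, and comparing the two bounds gives `m ≳ d²`. -/

/-! ### Moments of sums of independent samples -/

lemma expect_apply_coord {ι α : Type*} [Fintype ι] [DecidableEq ι] [Fintype α] [Nonempty α]
    (φ : α → ℝ) (j : ι) : (𝔼 Y : ι → α, φ (Y j)) = 𝔼 a, φ a := by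
  rw [Fintype.expect_equiv (Equiv.funSplitAt j α) (fun Y => φ (Y j)) (fun z => φ z.1)
    (fun Y => rfl), ← Finset.univ_product_univ, Finset.expect_product]
  exact Finset.expect_congr rfl fun x _ => Finset.expect_const Finset.univ_nonempty (φ x)

/-- The first moment of a sum of independent samples. -/
lemma expect_sum_apply {α : Type*} [Fintype α] [Nonempty α] (φ : α → ℝ) (k : ℕ) :
    (𝔼 Y : Fin k → α, ∑ j, φ (Y j)) = k * 𝔼 a, φ a := by
  rw [Finset.expect_sum_comm]
  simp [expect_apply_coord]

/-- The second moment of a sum of independent samples. -/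
lemma expect_sum_apply_sq_le {α : Type*} [Fintype α] [Nonempty α] (φ : α → ℝ) (k : ℕ) :
    (𝔼 Y : Fin k → α, (∑ j, φ (Y j)) ^ 2)
      ≤ k * (𝔼 a, φ a ^ 2) + (k : ℝ) ^ 2 * (𝔼 a, φ a) ^ 2 := by
  induction k with
  | zero => simp
  | succ k ih =>
    have h1 : (𝔼 Y : Fin (k + 1) → α, (∑ j, φ (Y j)) ^ 2)
        = 𝔼 a, 𝔼 Y : Fin k → α, (φ a ^ 2 + 2 * φ a * (∑ j, φ (Y j)) + (∑ j, φ (Y j)) ^ 2) := by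
      rw [← Finset.expect_product', Finset.univ_product_univ]
      refine (Fintype.expect_equiv (Fin.consEquiv fun _ => α) _ _ fun z => ?_).symm
      simp [Fin.sum_univ_succ]
      ring
    rw [h1]
    simp only [Finset.expect_add_distrib, ← Finset.mul_expect, ← Finset.expect_mul,
      Fintype.expect_const, expect_sum_apply]
    push_cast
    nlinarith [sq_nonneg (𝔼 a, φ a)]

/-- The second moment method. -/
lemma sq_expect_le_expect_ite_mul {Ω : Type*} [Fintype Ω] (T : Ω → ℝ) (p : Ω → Prop)
    [DecidablePred p] (hT : ∀ ω, T ω ≠ 0 → p ω) :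
    (𝔼 ω, T ω) ^ 2 ≤ (𝔼 ω, if p ω then (1 : ℝ) else 0) * 𝔼 ω, T ω ^ 2 := by
  have h := Finset.expect_mul_sq_le_sq_mul_sq (Finset.univ : Finset Ω)
    (fun ω => if p ω then (1 : ℝ) else 0) T
  have h1 (ω : Ω) : (if p ω then (1 : ℝ) else 0) * T ω = T ω := by
    by_cases hp : p ω
    · simp [hp]
    · have : T ω = 0 := by by_contra h; exact hp (hT ω h)
      simp [this]
  have h2 (ω : Ω) : (if p ω then (1 : ℝ) else 0) ^ 2 = if p ω then (1 : ℝ) else 0 := by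
    split_ifs <;> simp
  simpa only [h1, h2] using h

/-- The probability that a uniform sample of `l` vertices meets a set of density at least `1 / l`
is at least `1 / 2`. -/
lemma half_le_expect_ite_exists {α : Type*} [Fintype α] [Nonempty α] (p : α → Prop)
    [DecidablePred p] (l : ℕ) (hl : 1 ≤ (l : ℝ) * 𝔼 a, if p a then (1 : ℝ) else 0) :
    1 / 2 ≤ 𝔼 Y : Fin l → α, if ∃ j, p (Y j) then (1 : ℝ) else 0 := by
  set φ : α → ℝ := fun a => if p a then 1 else 0 with hφ
  have h := sq_expect_le_expect_ite_mul (fun Y : Fin l → α => ∑ j, φ (Y j))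
    (fun Y => ∃ j, p (Y j)) fun Y hY => by
      obtain ⟨j, -, hj⟩ := Finset.exists_ne_zero_of_sum_ne_zero hY
      exact ⟨j, by by_contra h; simp [hφ, h] at hj⟩
  have h2 := expect_sum_apply_sq_le φ l
  have h3 : ∀ a, φ a ^ 2 = φ a := fun a => by simp only [hφ]; split_ifs <;> simp
  simp only [h3] at h2
  rw [expect_sum_apply] at h
  set q := 𝔼 Y : Fin l → α, if ∃ j, p (Y j) then (1 : ℝ) else 0
  have hq : 0 ≤ q := Finset.expect_nonneg fun _ _ => by positivity
  -- The two moments give `t² ≤ q (t + t²)`, so `q ≥ t / (1 + t) ≥ 1/2` once `t ≥ 1`.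
  set t := (l : ℝ) * 𝔼 a, φ a with ht
  have hl' : 1 ≤ t := hl
  have h4 : t ^ 2 ≤ q * (t + t ^ 2) := h.trans (mul_le_mul_of_nonneg_left (by
    rw [ht, mul_pow]; exact h2) hq)
  by_contra! hc
  nlinarith

/-! ### Random graphs whose independent samples are seldom joined -/

section Graph

variable {α : Type*} [Fintype α] [Nonempty α] (B : α → α → Prop)

open Classical in
/-- The density of the neighbourhood of a vertex. -/
noncomputable def nbrDensity (x : α) : ℝ := 𝔼 y, if B x y then (1 : ℝ) else 0

open Classical in
/-- The probability that the samples `X` and `Y` are joined by an edge. -/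
noncomputable def crossProb (k l : ℕ) : ℝ :=
  𝔼 X : Fin k → α, 𝔼 Y : Fin l → α, if ∃ i j, B (X i) (Y j) then (1 : ℝ) else 0

open Classical in
/-- Vertices of high degree are rare when independent samples are seldom joined. -/
lemma expect_hub_le {k l : ℕ} (hk : 0 < k) :
    (𝔼 x, if 1 ≤ l * nbrDensity B x then (1 : ℝ) else 0) ≤ 2 * crossProb B k l := by
  obtain ⟨k, rfl⟩ := Nat.exists_eq_succ_of_ne_zero hk.ne'
  have h1 : (𝔼 x, if 1 ≤ l * nbrDensity B x then (1 : ℝ) else 0)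
      = 𝔼 X : Fin (k + 1) → α, if 1 ≤ l * nbrDensity B (X 0) then (1 : ℝ) else 0 :=
    (expect_apply_coord (fun x => if 1 ≤ l * nbrDensity B x then (1 : ℝ) else 0) 0).symm
  rw [h1, crossProb, Finset.mul_expect]
  -- If the single sample `X 0` is a hub, it already has a neighbour in `Y` with probability at
  -- least `1/2`.
  refine Finset.expect_le_expect fun X _ => ?_
  split_ifs with h
  · have h2 := half_le_expect_ite_exists (fun y => B (X 0) y) l h
    have h3 : (𝔼 Y : Fin l → α, if ∃ j, B (X 0) (Y j) then (1 : ℝ) else 0)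
        ≤ 𝔼 Y : Fin l → α, if ∃ i j, B (X i) (Y j) then (1 : ℝ) else 0 := by
      refine Finset.expect_le_expect fun Y _ => ?_
      split_ifs with h4 h5
      · exact le_rfl
      · exact absurd ⟨0, h4⟩ h5
      · exact zero_le_one
      · exact le_rfl
    linarith
  · exact mul_nonneg zero_le_two (Finset.expect_nonneg fun _ _ => by positivity)

open Classical in
/-- If independent samples are seldom joined by an edge, then few edges join vertices of low
degree. -/
lemma expect_edge_le {k l : ℕ} (hkl : k ≤ l) (hB : ∀ x y, B x y → B y x) :
    (k * l : ℝ) * (𝔼 x, 𝔼 y, if B x y ∧ l * nbrDensity B x < 1 ∧ l * nbrDensity B y < 1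
      then (1 : ℝ) else 0) * (1 - crossProb B k l) ≤ 3 * crossProb B k l := by
  set g : α → α → ℝ := fun x y => if B x y ∧ l * nbrDensity B x < 1 ∧ l * nbrDensity B y < 1
      then 1 else 0 with hg
  have g0 (x y) : 0 ≤ g x y := by simp only [hg]; positivity
  have gsymm (x y) : g x y = g y x := by
    have : B x y ↔ B y x := ⟨hB _ _, hB _ _⟩
    simp only [hg, this, and_comm]
  have gsq (x y) : g x y ^ 2 = g x y := by simp only [hg]; split_ifs <;> simp
  set h : α → ℝ := fun x => 𝔼 y, g x y with hh
  set p := 𝔼 x, h x with hp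
  have h0 (x) : 0 ≤ h x := Finset.expect_nonneg fun _ _ => g0 _ _
  have p0 : 0 ≤ p := Finset.expect_nonneg fun _ _ => h0 _
  -- Discarding hubs caps the remaining degrees at `1 / l`. This makes the variance terms from pairs
  -- of edges sharing a vertex comparable to the mean of `Z`.
  have hle (x) : l * h x ≤ 1 := by
    by_cases hx : l * nbrDensity B x < 1
    · refine le_trans (mul_le_mul_of_nonneg_left ?_ (Nat.cast_nonneg l)) hx.le
      refine Finset.expect_le_expect fun y _ => ?_
      simp only [hg]
      split_ifs with h1 h2 h2
      · exact le_rfl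
      · exact absurd h1.1 h2
      · exact zero_le_one
      · exact le_rfl
    · have : h x = 0 := by simp [hh, hg, hx]
      simp [this]
  have hsq : l * (𝔼 x, h x ^ 2) ≤ p := by
    rw [Finset.mul_expect]
    refine Finset.expect_le_expect fun x _ => ?_
    nlinarith [hle x, h0 x]
  set η := crossProb B k l
  have η0 : 0 ≤ η := Finset.expect_nonneg fun _ _ => Finset.expect_nonneg fun _ _ => by positivity
  let Z : (Fin k → α) × (Fin l → α) → ℝ := fun ω => ∑ j, ∑ i, g (ω.1 i) (ω.2 j)
  have hswap (y) : (𝔼 x, g x y) = h y := by simp only [hh, gsymm y]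
  have hEr (X : Fin k → α) : (𝔼 y, ∑ i, g (X i) y) = ∑ i, h (X i) := by
    rw [Finset.expect_sum_comm]
  have hZ1 : (𝔼 ω, Z ω) = k * l * p := by
    rw [← Finset.univ_product_univ, Finset.expect_product]
    have (X : Fin k → α) : (𝔼 Y : Fin l → α, Z (X, Y)) = l * ∑ i, h (X i) := by
      rw [← hEr]; exact expect_sum_apply (fun y => ∑ i, g (X i) y) l
    simp only [this]
    rw [← Finset.mul_expect, expect_sum_apply]
    ring
  have hZ2 : (𝔼 ω, Z ω ^ 2) ≤ l * (k * p + k ^ 2 * (𝔼 x, h x ^ 2))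
      + l ^ 2 * (k * (𝔼 x, h x ^ 2) + k ^ 2 * p ^ 2) := by
    rw [← Finset.univ_product_univ, Finset.expect_product]
    have h1 (X : Fin k → α) : (𝔼 Y : Fin l → α, Z (X, Y) ^ 2)
        ≤ l * (𝔼 y, (∑ i, g (X i) y) ^ 2) + (l : ℝ) ^ 2 * (∑ i, h (X i)) ^ 2 := by
      rw [← hEr]; exact expect_sum_apply_sq_le (fun y => ∑ i, g (X i) y) l
    refine (Finset.expect_le_expect fun X _ => h1 X).trans ?_
    rw [Finset.expect_add_distrib, ← Finset.mul_expect, ← Finset.mul_expect, Finset.expect_comm]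
    refine add_le_add (mul_le_mul_of_nonneg_left ?_ (by positivity))
      (mul_le_mul_of_nonneg_left (expect_sum_apply_sq_le h k) (by positivity))
    have h2 (y : α) : (𝔼 X : Fin k → α, (∑ i, g (X i) y) ^ 2) ≤ k * h y + (k : ℝ) ^ 2 * h y ^ 2 := by
      have := expect_sum_apply_sq_le (fun x => g x y) k
      simpa only [gsq, hswap] using this
    refine (Finset.expect_le_expect fun y _ => h2 y).trans ?_
    rw [Finset.expect_add_distrib, ← Finset.mul_expect, ← Finset.mul_expect]
  have hCS := sq_expect_le_expect_ite_mul Z (fun ω => ∃ i j, B (ω.1 i) (ω.2 j)) fun ω hω => by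
    obtain ⟨j, -, hj⟩ := Finset.exists_ne_zero_of_sum_ne_zero hω
    obtain ⟨i, -, hi⟩ := Finset.exists_ne_zero_of_sum_ne_zero hj
    exact ⟨i, j, by by_contra hc; simp [hg, hc] at hi⟩
  have hη' : (𝔼 ω : (Fin k → α) × (Fin l → α), if ∃ i j, B (ω.1 i) (ω.2 j) then (1 : ℝ) else 0)
      = η := by
    rw [← Finset.univ_product_univ, Finset.expect_product]; rfl
  rw [hη', hZ1] at hCS
  have hkl' : (k : ℝ) ≤ l := by exact_mod_cast hkl
  have hk0 : (0 : ℝ) ≤ k := Nat.cast_nonneg k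
  have hl0 : (0 : ℝ) ≤ l := Nat.cast_nonneg l
  set t := (k * l : ℝ) * p with ht
  have ht0 : 0 ≤ t := by positivity
  have hZ3 : (𝔼 ω, Z ω ^ 2) ≤ 3 * t + t ^ 2 := by
    refine hZ2.trans ?_
    -- The two shared-vertex terms are each at most `t`; the one with `k²` needs `k ≤ l`.
    have e1 : (k : ℝ) ^ 2 * (l * 𝔼 x, h x ^ 2) ≤ t := by
      calc (k : ℝ) ^ 2 * (l * 𝔼 x, h x ^ 2) ≤ (k : ℝ) ^ 2 * p := by gcongr
        _ ≤ t := by rw [ht]; nlinarith [mul_nonneg hk0 p0]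
    have e2 : (k * l : ℝ) * (l * 𝔼 x, h x ^ 2) ≤ t := by
      rw [ht]; gcongr
    nlinarith
  have hfin : t ^ 2 ≤ η * (3 * t + t ^ 2) := hCS.trans (by gcongr)
  rcases ht0.eq_or_lt with h | h
  · rw [← h]; linarith
  · have : t * (t * (1 - η)) ≤ t * (3 * η) := by nlinarith
    exact le_of_mul_le_mul_left this h

end Graph

/-! ### Correlations among sparse vectors of norm near one -/

/-- The part of a vector formed by its entries of square at least `θ`. -/
noncomputable def heavyPart {m : ℕ} (θ : ℝ) (u : Fin m → ℝ) (r : Fin m) : ℝ :=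
  if θ ≤ u r ^ 2 then u r else 0

lemma heavyPart_mul_self {m : ℕ} (θ : ℝ) (u : Fin m → ℝ) (r : Fin m) :
    heavyPart θ u r * u r = heavyPart θ u r ^ 2 := by
  unfold heavyPart; split_ifs <;> ring

lemma heavyPart_sq_le {m : ℕ} (θ : ℝ) (u : Fin m → ℝ) (r : Fin m) :
    heavyPart θ u r ^ 2 ≤ u r ^ 2 := by
  unfold heavyPart
  split_ifs
  · exact le_rfl
  · simpa using sq_nonneg (u r)

/-- A retained entry is `0` or at least `√θ` in size. This lets second moments control first
absolute moments, which is where sparsity beats a small inner product. -/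
lemma sqrt_mul_abs_heavyPart_le {m : ℕ} (θ : ℝ) (u : Fin m → ℝ) (r : Fin m) :
    √θ * |heavyPart θ u r| ≤ heavyPart θ u r ^ 2 := by
  unfold heavyPart
  split_ifs with h
  · rw [← sq_abs (u r), sq]
    exact mul_le_mul_of_nonneg_right (Real.sqrt_le_iff.2 ⟨abs_nonneg _, by simpa using h⟩)
      (abs_nonneg _)
  · simp

open Classical in
/-- A sparse vector loses little mass when its light entries are dropped. -/
lemma sum_sq_sub_le_sum_heavyPart_sq {m s : ℕ} {θ : ℝ} (hθ : 0 ≤ θ) (u : Fin m → ℝ)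
    (hs : (Finset.univ.filter fun i => u i ≠ 0).card ≤ s) :
    ∑ r, u r ^ 2 - s * θ ≤ ∑ r, heavyPart θ u r ^ 2 := by
  have h1 : ∀ r, u r ^ 2 - (if u r ≠ 0 then θ else 0) ≤ heavyPart θ u r ^ 2 := by
    intro r
    unfold heavyPart
    by_cases h : u r = 0
    · simp [h]
    · rw [if_pos h]
      split_ifs with h2 <;> nlinarith
  have h2 := Finset.sum_le_sum fun r (_ : r ∈ Finset.univ) => h1 r
  rw [Finset.sum_sub_distrib, ← Finset.sum_filter, Finset.sum_const, nsmul_eq_mul] at h2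
  have h3 : ((Finset.univ.filter fun i => u i ≠ 0).card : ℝ) * θ ≤ s * θ :=
    mul_le_mul_of_nonneg_right (by exact_mod_cast hs) hθ
  linarith

/-- The average of the product of the two Gram kernels of random vectors `f` and `u`. -/
lemma expect_gram_mul_gram {α : Type*} [Fintype α] {m : ℕ} (f u : α → Fin m → ℝ) :
    (𝔼 x, 𝔼 y, (∑ r, f x r * f y r) * ∑ i, u x i * u y i)
      = ∑ r, ∑ i, (𝔼 x, f x r * u x i) ^ 2 := by
  simp_rw [Finset.sum_mul_sum, Finset.expect_sum_comm, sq, Finset.expect_mul_expect]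
  refine Finset.sum_congr rfl fun r _ => Finset.sum_congr rfl fun i _ => ?_
  refine Finset.expect_congr rfl fun x _ => Finset.expect_congr rfl fun y _ => by ring

lemma abs_sum_mul_le {m : ℕ} {R : ℝ} (hR : 0 ≤ R) (a b : Fin m → ℝ) (ha : ∑ i, a i ^ 2 ≤ R)
    (hb : ∑ i, b i ^ 2 ≤ R) : |∑ i, a i * b i| ≤ R := by
  refine abs_le_of_sq_le_sq ?_ hR
  calc (∑ i, a i * b i) ^ 2 ≤ (∑ i, a i ^ 2) * ∑ i, b i ^ 2 := Finset.sum_mul_sq_le_sq_mul_sq _ _ _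
    _ ≤ R * R := mul_le_mul ha hb (Finset.sum_nonneg fun _ _ => sq_nonneg _) hR
    _ = R ^ 2 := by ring

open Classical in
/-- Random sparse vectors of norm close to `1` in dimension `m` have a substantial inner product
with probability at least of order `1 / m`. -/
lemma le_expect_abs_inner_gt {α : Type*} [Fintype α] [Nonempty α] {m s : ℕ} {ε : ℝ}
    (u : α → Fin m → ℝ) (A : α → Prop) (hε : 0 < ε) (hε' : ε < 1 / 20) (hs : 1 ≤ s)
    (hsε : (s : ℝ) ≤ 1 / (9 * ε))
    (hsparse : ∀ x, (Finset.univ.filter fun i => u x i ≠ 0).card ≤ s)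
    (hlow : ∀ x, A x → (1 - ε) ^ 2 ≤ ∑ i, u x i ^ 2)
    (hup : ∀ x, A x → ∑ i, u x i ^ 2 ≤ (1 + ε) ^ 2)
    (hA : 1 / 2 ≤ 𝔼 x, if A x then (1 : ℝ) else 0) :
    1 ≤ 100 * (m : ℝ) * 𝔼 x, 𝔼 y, if A x ∧ A y ∧ 2 * ε < |∑ i, u x i * u y i|
      then (1 : ℝ) else 0 := by
  have hs0 : (0 : ℝ) < s := by exact_mod_cast hs
  -- With this threshold a column loses at most `s * θ = 1/2` of its squared norm, while `s ≤ 1 /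
  -- (9ε)` still gives `2ε ≤ (4/9) θ`.
  set θ : ℝ := 1 / (2 * s) with hθ
  have hθ0 : 0 < θ := by positivity
  have hsθ : s * θ = 1 / 2 := by rw [hθ]; field_simp
  have hεθ : 2 * ε ≤ 4 / 9 * θ := by
    have h1 : s * (9 * ε) ≤ 1 := (le_div_iff₀ (by positivity)).1 hsε
    have h2 : s * (2 * ε) ≤ s * (4 / 9 * θ) := by
      have : s * (4 / 9 * θ) = 2 / 9 := by linear_combination 4 / 9 * hsθ
      rw [this]; linarith
    exact le_of_mul_le_mul_left h2 hs0
  set f : α → Fin m → ℝ := fun x r => if A x then heavyPart θ (u x) r else 0 with hf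
  set v : α → Fin m → ℝ := fun x r => if A x then u x r else 0 with hv
  have hfv (x r) : f x r * v x r = f x r ^ 2 := by
    simp only [hf, hv]; split_ifs <;> simp [heavyPart_mul_self]
  have hfsq (x r) : f x r ^ 2 ≤ v x r ^ 2 := by
    simp only [hf, hv]; split_ifs <;> simp [heavyPart_sq_le]
  have hfabs (x r) : √θ * |f x r| ≤ f x r ^ 2 := by
    simp only [hf]; split_ifs <;> simp [sqrt_mul_abs_heavyPart_le]
  have hvR (x) : ∑ i, v x i ^ 2 ≤ (1 + ε) ^ 2 := by
    by_cases h : A x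
    · simpa [hv, h] using hup x h
    · simp [hv, h]; positivity
  have hfR (x) : ∑ i, f x i ^ 2 ≤ (1 + ε) ^ 2 :=
    (Finset.sum_le_sum fun i _ => hfsq x i).trans (hvR x)
  set F : Fin m → ℝ := fun r => 𝔼 x, f x r ^ 2 with hF
  have hsum : 1 / 5 ≤ ∑ r, F r := by
    rw [hF, ← Finset.expect_sum_comm]
    -- For `ε < 1/20` the mass left is at least `(19/20)² - 1/2 > 2/5`.
    have : ∀ x, 2 / 5 * (if A x then (1 : ℝ) else 0) ≤ ∑ r, f x r ^ 2 := by
      intro x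
      by_cases h : A x
      · have h1 := sum_sq_sub_le_sum_heavyPart_sq hθ0.le (u x) (hsparse x)
        have h2 := hlow x h
        simp only [hf, h, if_true]
        nlinarith
      · simp [hf, h]
    have h3 := Finset.expect_le_expect fun x (_ : x ∈ Finset.univ) => this x
    rw [← Finset.mul_expect] at h3
    linarith
  have hCS : (∑ r, F r) ^ 2 ≤ m * ∑ r, F r ^ 2 := by
    have := sq_sum_le_card_mul_sum_sq (s := Finset.univ) (f := F)
    simpa using this
  -- Only the diagonal terms `i = r` of the sum of squares are kept; there `f * v = f²`.
  have hmain : ∑ r, F r ^ 2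
      ≤ 𝔼 x, 𝔼 y, (∑ r, f x r * f y r) * ∑ i, v x i * v y i := by
    rw [expect_gram_mul_gram]
    refine Finset.sum_le_sum fun r _ => ?_
    have : F r ^ 2 = (𝔼 x, f x r * v x r) ^ 2 := by simp only [hF, hfv]
    rw [this]
    exact Finset.single_le_sum (f := fun i => (𝔼 x, f x r * v x i) ^ 2)
      (fun i _ => sq_nonneg _) (Finset.mem_univ r)
  -- Uncorrelated pairs pay the factor `2ε`; correlated ones are bounded by Cauchy–Schwarz on both
  -- kernels; pairs outside `A` contribute zero.
  have hpt (x y) : (∑ r, f x r * f y r) * ∑ i, v x i * v y i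
      ≤ 2 * ε * ∑ r, |f x r| * |f y r| + (1 + ε) ^ 4 *
        if A x ∧ A y ∧ 2 * ε < |∑ i, u x i * u y i| then (1 : ℝ) else 0 := by
    have hK : |∑ r, f x r * f y r| ≤ ∑ r, |f x r| * |f y r| := by
      simpa only [abs_mul] using Finset.abs_sum_le_sum_abs (fun r => f x r * f y r) Finset.univ
    have hnn : 0 ≤ ∑ r, |f x r| * |f y r| := (abs_nonneg _).trans hK
    have hle := le_abs_self ((∑ r, f x r * f y r) * ∑ i, v x i * v y i)
    rw [abs_mul] at hle
    by_cases hxy : A x ∧ A y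
    · have hvu : ∑ i, v x i * v y i = ∑ i, u x i * u y i := by simp [hv, hxy.1, hxy.2]
      by_cases hb : 2 * ε < |∑ i, u x i * u y i|
      · rw [if_pos ⟨hxy.1, hxy.2, hb⟩]
        have h1 := abs_sum_mul_le (sq_nonneg _) (f x) (f y) (hfR x) (hfR y)
        have h2 := abs_sum_mul_le (sq_nonneg _) (v x) (v y) (hvR x) (hvR y)
        have h3 := mul_le_mul h1 h2 (abs_nonneg _) (by positivity)
        have h4 : 0 ≤ 2 * ε * ∑ r, |f x r| * |f y r| := by positivity
        nlinarith
      · rw [if_neg fun h => hb h.2.2]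
        rw [hvu] at hle ⊢
        have h3 := mul_le_mul hK (not_lt.1 hb) (abs_nonneg _) hnn
        linarith
    · have h0 : ∑ i, v x i * v y i = 0 := Finset.sum_eq_zero fun i _ => by
        simp only [hv]
        by_cases h : A x
        · simp [show ¬ A y from fun h' => hxy ⟨h, h'⟩]
        · simp [h]
      rw [h0, mul_zero]
      positivity
  have hlight : 2 * ε * ∑ r, (𝔼 x, |f x r|) ^ 2 ≤ 4 / 9 * ∑ r, F r ^ 2 := by
    rw [Finset.mul_sum, Finset.mul_sum]
    refine Finset.sum_le_sum fun r _ => ?_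
    have h1 : √θ * (𝔼 x, |f x r|) ≤ F r := by
      rw [Finset.mul_expect]
      exact Finset.expect_le_expect fun x _ => hfabs x r
    have h2 : 0 ≤ √θ * (𝔼 x, |f x r|) :=
      mul_nonneg (Real.sqrt_nonneg _) (Finset.expect_nonneg fun _ _ => abs_nonneg _)
    have h3 : θ * (𝔼 x, |f x r|) ^ 2 ≤ F r ^ 2 := by
      have := pow_le_pow_left₀ h2 h1 2
      rwa [mul_pow, Real.sq_sqrt hθ0.le] at this
    calc 2 * ε * (𝔼 x, |f x r|) ^ 2 ≤ 4 / 9 * θ * (𝔼 x, |f x r|) ^ 2 := by gcongr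
      _ ≤ 4 / 9 * F r ^ 2 := by rw [mul_assoc]; gcongr
  set p := 𝔼 x, 𝔼 y, if A x ∧ A y ∧ 2 * ε < |∑ i, u x i * u y i| then (1 : ℝ) else 0 with hp
  have hp0 : 0 ≤ p := Finset.expect_nonneg fun _ _ => Finset.expect_nonneg fun _ _ => by positivity
  have hexp : (𝔼 x, 𝔼 y, (∑ r, f x r * f y r) * ∑ i, v x i * v y i)
      ≤ 2 * ε * ∑ r, (𝔼 x, |f x r|) ^ 2 + (1 + ε) ^ 4 * p := by
    refine (Finset.expect_le_expect fun x _ => Finset.expect_le_expect fun y _ =>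
      hpt x y).trans (le_of_eq ?_)
    simp only [Finset.expect_add_distrib, ← Finset.mul_expect, Finset.expect_sum_comm, sq,
      Finset.expect_mul_expect, hp]
  have h4 : (1 + ε) ^ 4 ≤ 5 / 4 := by
    calc (1 + ε) ^ 4 ≤ (1 + 1 / 20) ^ 4 := by gcongr
      _ ≤ 5 / 4 := by norm_num
  have h5 : 5 / 9 * ∑ r, F r ^ 2 ≤ 5 / 4 * p := by
    have := mul_le_mul_of_nonneg_right h4 hp0
    linarith
  have h6 : (1 / 5 : ℝ) ^ 2 ≤ (∑ r, F r) ^ 2 := pow_le_pow_left₀ (by norm_num) hsum 2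
  have h7 : (m : ℝ) * ∑ r, F r ^ 2 ≤ m * (9 / 4 * p) :=
    mul_le_mul_of_nonneg_left (by linarith) (Nat.cast_nonneg m)
  nlinarith

/-! ### What an embedding for `𝒟_1` says about the columns of `P` -/

open Classical in
lemma uniformOfFintype_toOuterMeasure {Ω : Type*} [Fintype Ω] [Nonempty Ω] (S : Set Ω) :
    (PMF.uniformOfFintype Ω).toOuterMeasure S
      = ENNReal.ofReal (𝔼 ω, if ω ∈ S then (1 : ℝ) else 0) := by
  rw [PMF.toOuterMeasure_uniformOfFintype_apply, Fintype.expect_eq_sum_div_card,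
    Finset.sum_boole, ENNReal.ofReal_div_of_pos (by exact_mod_cast Fintype.card_pos),
    ENNReal.ofReal_natCast, ENNReal.ofReal_natCast, Fintype.card_subtype]

/-- An embedding for the mixture is one for its component `𝒟_1`, with twice the failure
probability. -/
lemma IsSubspaceEmbedding.hardDist_one {m n d L : ℕ} [NeZero n] {hL : 1 ≤ L} {ε δ : ℝ}
    {P : Matrix (Fin m) (Fin n) ℝ}
    (h : IsSubspaceEmbedding ε δ P (mixedHardDist n d L hL)) :
    IsSubspaceEmbedding ε (2 * δ) P (hardDist n d 1) := by
  unfold IsSubspaceEmbedding mixedHardDist at *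
  rw [PMF.toOuterMeasure_bind_apply, tsum_bool] at h
  simp only [PMF.uniformOfFintype_apply, Fintype.card_bool, Bool.false_eq_true, if_false,
    if_true] at h
  set S := {A : Matrix (Fin n) (Fin d) ℝ | EmbedsColumnSpace ε P A}
  set q := (hardDist n d 1).toOuterMeasure S
  have hone {D : PMF (Matrix (Fin n) (Fin d) ℝ)} : D.toOuterMeasure S ≤ 1 := by
    rw [PMF.toOuterMeasure_apply, ← D.tsum_coe]
    exact ENNReal.tsum_le_tsum fun x => Set.indicator_le_self _ _ _
  -- Bounding the success probability of the other half of the mixture by `1` leaves `1 - δ ≤ 1/2 +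
  -- q/2`, that is `q ≥ 1 - 2δ`.
  have h2 : ENNReal.ofReal (1 - δ) ≤ ENNReal.ofReal (1 / 2) * 1 + ENNReal.ofReal (1 / 2) * q := by
    have e : ENNReal.ofReal (1 / 2) = ((2 : ℕ) : ENNReal)⁻¹ := by
      rw [one_div, ENNReal.ofReal_inv_of_pos two_pos]; simp
    rw [e]
    refine h.trans (add_le_add_left (mul_le_mul_right ?_ _) _)
    exact hone
  have hq : q ≠ ⊤ := ne_top_of_le_ne_top ENNReal.one_ne_top hone
  rw [← ENNReal.ofReal_toReal hq, mul_one, ← ENNReal.ofReal_mul (by norm_num),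
    ← ENNReal.ofReal_add (by norm_num) (by positivity),
    ENNReal.ofReal_le_ofReal_iff (by positivity)] at h2
  rw [← ENNReal.ofReal_toReal hq]
  exact ENNReal.ofReal_le_ofReal (by linarith)

open Classical in
/-- An event for the positions of the nonzero entries that excludes an embedding is rare. -/
lemma IsSubspaceEmbedding.expect_ite_le {m n d : ℕ} [NeZero n] {ε δ : ℝ}
    {P : Matrix (Fin m) (Fin n) ℝ} (h : IsSubspaceEmbedding ε δ P (hardDist n d 1))
    (Q : (Fin d × Fin 1 → Fin n) → Prop)
    (hQ : ∀ c σ, EmbedsColumnSpace ε P (basisColumns c * signedBlocks σ) → ¬ Q c) :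
    (𝔼 c, if Q c then (1 : ℝ) else 0) ≤ δ := by
  unfold IsSubspaceEmbedding hardDist at h
  rw [PMF.toOuterMeasure_map_apply, uniformOfFintype_toOuterMeasure,
    ENNReal.ofReal_le_ofReal_iff (Finset.expect_nonneg fun _ _ => by positivity)] at h
  have h1 : (𝔼 ω : (Fin d × Fin 1 → Fin n) × (Fin d × Fin 1 → ℤˣ), if Q ω.1 then (1 : ℝ) else 0)
      = 𝔼 c, if Q c then (1 : ℝ) else 0 := by
    rw [← Finset.univ_product_univ, Finset.expect_product]
    exact Finset.expect_congr rfl fun x _ => Finset.expect_const Finset.univ_nonempty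
      (if Q x then (1 : ℝ) else 0)
  have h2 := Finset.expect_le_expect
    fun (ω : (Fin d × Fin 1 → Fin n) × (Fin d × Fin 1 → ℤˣ)) (_ : ω ∈ Finset.univ) =>
    show (if ω ∈ (fun ω : (Fin d × Fin 1 → Fin n) × (Fin d × Fin 1 → ℤˣ) =>
        basisColumns ω.1 * signedBlocks ω.2) ⁻¹' {A | EmbedsColumnSpace ε P A}
      then (1 : ℝ) else 0) + (if Q ω.1 then (1 : ℝ) else 0) ≤ 1 by
    by_cases hE : EmbedsColumnSpace ε P (basisColumns ω.1 * signedBlocks ω.2)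
    · simp [hE, hQ _ _ hE]
    · simp only [Set.mem_preimage, Set.mem_ofPred_eq, hE, if_false]
      split_ifs <;> norm_num
  rw [Finset.expect_add_distrib, h1, Fintype.expect_const] at h2
  linarith

/-- Putting the sign into the test vector cancels it, so everything later depends on the positions
`c` only. -/
lemma basisColumns_mul_signedBlocks_mulVec_single {n d : ℕ} (c : Fin d × Fin 1 → Fin n)
    (σ : Fin d × Fin 1 → ℤˣ) (i : Fin d) (t : ℝ) :
    (basisColumns c * signedBlocks σ).mulVec (Pi.single i (t * (((σ (i, 0) : ℤˣ) : ℤ) : ℝ)))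
      = Pi.single (c (i, 0)) t := by
  have hσ : (((σ (i, 0) : ℤˣ) : ℤ) : ℝ) * (((σ (i, 0) : ℤˣ) : ℤ) : ℝ) = 1 := by
    rcases Int.units_eq_one_or (σ (i, 0)) with h | h <;> simp [h]
  ext r
  rw [Matrix.mulVec_single]
  simp only [Matrix.col_apply, Matrix.mul_apply, basisColumns, signedBlocks, Matrix.of_apply,
    Pi.smul_apply, Fintype.sum_prod_type, Fin.sum_univ_one, Pi.single_apply]
  rw [Finset.sum_eq_single i]
  · by_cases h : r = c (i, 0)
    · simp only [h, MulOpposite.smul_eq_mul_unop, MulOpposite.unop_op]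
      simp
      linear_combination t * hσ
    · simp [h]
  · intro b _ hb
    simp [hb]
  · simp

/-- The embedding property in squared coordinates. -/
lemma EmbedsColumnSpace.sum_sq {m n d : ℕ} {ε : ℝ} (hε' : ε ≤ 1)
    {P : Matrix (Fin m) (Fin n) ℝ} {A : Matrix (Fin n) (Fin d) ℝ} (h : EmbedsColumnSpace ε P A)
    (x : Fin d → ℝ) :
    (1 - ε) ^ 2 * ∑ r, (A.mulVec x) r ^ 2 ≤ ∑ r, (P.mulVec (A.mulVec x)) r ^ 2 ∧
      ∑ r, (P.mulVec (A.mulVec x)) r ^ 2 ≤ (1 + ε) ^ 2 * ∑ r, (A.mulVec x) r ^ 2 := by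
  have e1 := EuclideanSpace.real_norm_sq_eq (WithLp.toLp 2 (A.mulVec x))
  have e2 := EuclideanSpace.real_norm_sq_eq (WithLp.toLp 2 (P.mulVec (A.mulVec x)))
  simp only at e1 e2
  obtain ⟨h1, h2⟩ := h x
  rw [← Matrix.mulVec_mulVec] at h1 h2
  rw [← e1, ← e2, ← mul_pow, ← mul_pow]
  exact ⟨pow_le_pow_left₀ (mul_nonneg (by linarith) (norm_nonneg _)) h1 2,
    pow_le_pow_left₀ (norm_nonneg _) h2 2⟩

lemma EmbedsColumnSpace.sum_sq_col {m n d : ℕ} {ε : ℝ} (hε' : ε ≤ 1)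
    {P : Matrix (Fin m) (Fin n) ℝ} {c : Fin d × Fin 1 → Fin n} {σ : Fin d × Fin 1 → ℤˣ}
    (h : EmbedsColumnSpace ε P (basisColumns c * signedBlocks σ)) (i : Fin d) :
    (1 - ε) ^ 2 ≤ ∑ r, P r (c (i, 0)) ^ 2 ∧ ∑ r, P r (c (i, 0)) ^ 2 ≤ (1 + ε) ^ 2 := by
  have := h.sum_sq hε' (Pi.single i (1 * (((σ (i, 0) : ℤˣ) : ℤ) : ℝ)))
  rw [basisColumns_mul_signedBlocks_mulVec_single, Matrix.mulVec_single_one] at this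
  simpa [Pi.single_apply] using this

/-- Polarization: testing on the sum and difference of two distinct basis vectors, both of squared
norm `2`, bounds four times the inner product by `2 ((1 + ε)² - (1 - ε)²) = 8ε`. -/
lemma EmbedsColumnSpace.abs_sum_mul_col_le {m n d : ℕ} {ε : ℝ} (hε' : ε ≤ 1)
    {P : Matrix (Fin m) (Fin n) ℝ} {c : Fin d × Fin 1 → Fin n} {σ : Fin d × Fin 1 → ℤˣ}
    (h : EmbedsColumnSpace ε P (basisColumns c * signedBlocks σ)) (i j : Fin d)
    (hij : c (i, 0) ≠ c (j, 0)) :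
    |∑ r, P r (c (i, 0)) * P r (c (j, 0))| ≤ 2 * ε := by
  have key (t : ℝ) := h.sum_sq hε' (Pi.single i (1 * (((σ (i, 0) : ℤˣ) : ℤ) : ℝ))
    + Pi.single j (t * (((σ (j, 0) : ℤˣ) : ℤ) : ℝ)))
  simp only [Matrix.mulVec_add, basisColumns_mul_signedBlocks_mulVec_single] at key
  simp only [Matrix.mulVec_single, Pi.add_apply, Pi.smul_apply, Matrix.col_apply,
    MulOpposite.smul_eq_mul_unop, MulOpposite.unop_op, add_sq, Finset.sum_add_distrib] at key
  have e (t : ℝ) : ∑ r, 2 * (P r (c (i, 0)) * 1) * (P r (c (j, 0)) * t)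
      = 2 * t * ∑ r, P r (c (i, 0)) * P r (c (j, 0)) := by
    rw [Finset.mul_sum]; exact Finset.sum_congr rfl fun _ _ => by ring
  have e' (t : ℝ) : ∑ r, 2 * (Pi.single (c (i, 0)) 1 : Fin n → ℝ) r * (Pi.single (c (j, 0)) t : Fin n → ℝ) r = 0 := by
    simp [Pi.single_apply, hij.symm]
  have k1 := key 1
  have k2 := key (-1)
  simp only [e, e'] at k1 k2
  simp [Pi.single_apply] at k1 k2
  rw [abs_le]
  constructor <;> nlinarith

/-- Two distinct columns of `P` have an inner product exceeding `2 * ε` in absolute value. -/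
def ColumnsCorrelated {m n : ℕ} (ε : ℝ) (P : Matrix (Fin m) (Fin n) ℝ) (x y : Fin n) : Prop :=
  x ≠ y ∧ 2 * ε < |∑ r, P r x * P r y|

/-- The squared norm of a column of `P` is close to `1`. -/
def ColumnNormClose {m n : ℕ} (ε : ℝ) (P : Matrix (Fin m) (Fin n) ℝ) (x : Fin n) : Prop :=
  (1 - ε) ^ 2 ≤ ∑ r, P r x ^ 2 ∧ ∑ r, P r x ^ 2 ≤ (1 + ε) ^ 2

/-- The `k + l` independent positions split into two independent samples, and any edge between them
rules out an embedding. -/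
lemma IsSubspaceEmbedding.crossProb_le {m n k l : ℕ} [NeZero n] {ε δ : ℝ} (hε : ε ≤ 1)
    {P : Matrix (Fin m) (Fin n) ℝ} (h : IsSubspaceEmbedding ε δ P (hardDist n (k + l) 1)) :
    crossProb (ColumnsCorrelated ε P) k l ≤ δ := by
  classical
  let e : Fin k ⊕ Fin l ≃ Fin (k + l) × Fin 1 := finSumFinEquiv.trans (Equiv.prodUnique _ _).symm
  have h1 := h.expect_ite_le (fun c => ∃ i j, ColumnsCorrelated ε P (c (e (Sum.inl i)))
      (c (e (Sum.inr j)))) fun c σ hE => by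
    rintro ⟨i, j, hne, hlt⟩
    exact absurd hlt (not_lt.2 (hE.abs_sum_mul_col_le hε _ _ hne))
  refine le_trans (le_of_eq ?_) h1
  rw [crossProb, ← Finset.expect_product', Finset.univ_product_univ]
  refine (Fintype.expect_equiv ((e.symm.arrowCongr (Equiv.refl (Fin n))).trans
    (Equiv.sumArrowEquivProdArrow _ _ _)) _ _ fun c => ?_).symm
  simp [Equiv.arrowCongr, Equiv.sumArrowEquivProdArrow]

open Classical in
lemma IsSubspaceEmbedding.expect_not_columnNormClose_le {m n d : ℕ} [NeZero n] {ε δ : ℝ}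
    (hε : ε ≤ 1) (hd : 0 < d) {P : Matrix (Fin m) (Fin n) ℝ}
    (h : IsSubspaceEmbedding ε δ P (hardDist n d 1)) :
    (𝔼 x, if ¬ ColumnNormClose ε P x then (1 : ℝ) else 0) ≤ δ := by
  have h1 := h.expect_ite_le (fun c => ¬ ColumnNormClose ε P (c (⟨0, hd⟩, 0)))
    fun c σ hE hn => hn (hE.sum_sq_col hε _)
  refine le_trans (le_of_eq ?_) h1
  convert (expect_apply_coord (fun x => if ¬ ColumnNormClose ε P x then (1 : ℝ) else 0)
    ((⟨0, hd⟩, 0) : Fin d × Fin 1)).symm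

/-! ### Comparison of the two bounds -/

/-- A sparse embedding for `𝒟_1` has at least of order `d ^ 2` rows. -/
lemma IsSubspaceEmbedding.sq_le_rows {m n d s : ℕ} [NeZero n] {ε δ : ℝ}
    {P : Matrix (Fin m) (Fin n) ℝ} (hε : 0 < ε) (hε' : ε < 1 / 20) (hδ' : δ ≤ 1 / 50)
    (hd : 3 ≤ d) (hs : 1 ≤ s) (hsε : (s : ℝ) ≤ 1 / (9 * ε)) (hn : (d : ℝ) ^ 2 ≤ n)
    (hsparse : columnSparsity P ≤ s) (h : IsSubspaceEmbedding ε δ P (hardDist n d 1)) :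
    (d : ℝ) ^ 2 ≤ 200 * m := by
  classical
  obtain ⟨k, l, hdk, hkl, hlk⟩ : ∃ k l, d = k + l ∧ k ≤ l ∧ l ≤ k + 1 :=
    ⟨d / 2, d - d / 2, by omega, by omega, by omega⟩
  set B := ColumnsCorrelated ε P
  set η := crossProb B k l
  have hη1 : η ≤ 1 / 50 := by
    subst hdk
    exact (h.crossProb_le (by linarith)).trans hδ'
  have hnorm := h.expect_not_columnNormClose_le (by linarith) (by omega)
  have hhub := expect_hub_le B (k := k) (l := l) (by omega)
  have hedge := expect_edge_le B hkl fun x y hxy => ⟨hxy.1.symm, by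
    have := hxy.2
    simpa only [mul_comm] using this⟩
  obtain ⟨A, hA⟩ : ∃ A : Fin n → Prop,
      ∀ x, A x ↔ ColumnNormClose ε P x ∧ l * nbrDensity B x < 1 := ⟨_, fun _ => Iff.rfl⟩
  -- Columns of bad norm have density at most `1/50` and hubs at most `2/50`.
  have hAmass : 1 / 2 ≤ 𝔼 x, if A x then (1 : ℝ) else 0 := by
    have h1 := Finset.expect_le_expect fun (x : Fin n) (_ : x ∈ Finset.univ) =>
      show (1 : ℝ) ≤ (if A x then (1 : ℝ) else 0)
        + (if ¬ ColumnNormClose ε P x then (1 : ℝ) else 0)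
        + (if 1 ≤ l * nbrDensity B x then (1 : ℝ) else 0) by
      by_cases h1 : ColumnNormClose ε P x <;> by_cases h2 : 1 ≤ l * nbrDensity B x
      · simp [h1, h2, hA, not_lt.2 h2]
      · simp [h1, h2, hA, not_le.1 h2]
      · simp [h1, h2, hA]
      · simp [h1, h2, hA]
    rw [Finset.expect_add_distrib, Finset.expect_add_distrib, Fintype.expect_const] at h1
    linarith
  have hmain := le_expect_abs_inner_gt (fun x r => P r x) A hε hε' hs hsε
    (fun x => by
      refine le_trans ?_ hsparse
      unfold columnSparsity
      convert Finset.le_sup (f := fun j => (Finset.univ.filter fun i => P i j ≠ 0).card)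
        (Finset.mem_univ x))
    (fun x hx => ((hA x).1 hx).1.1) (fun x hx => ((hA x).1 hx).1.2) hAmass
  set p' := 𝔼 x, 𝔼 y, if B x y ∧ l * nbrDensity B x < 1 ∧ l * nbrDensity B y < 1
      then (1 : ℝ) else 0 with hp'
  have hp'0 : 0 ≤ p' := Finset.expect_nonneg fun _ _ => Finset.expect_nonneg fun _ _ => by
    positivity
  have hsplit : (𝔼 x, 𝔼 y, if A x ∧ A y ∧ 2 * ε < |∑ r, P r x * P r y| then (1 : ℝ) else 0)
      ≤ (n : ℝ)⁻¹ + p' := by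
    -- The lower bound also counts pairs `x = y`, which are not edges; their density `1 / n` is
    -- harmless because `n ≥ d²`.
    have hdiag : (𝔼 x : Fin n, 𝔼 y : Fin n, if x = y then (1 : ℝ) else 0) = (n : ℝ)⁻¹ := by
      simp
    rw [← hdiag, hp', ← Finset.expect_add_distrib]
    refine Finset.expect_le_expect fun x _ => ?_
    rw [← Finset.expect_add_distrib]
    refine Finset.expect_le_expect fun y _ => ?_
    by_cases hc : A x ∧ A y ∧ 2 * ε < |∑ r, P r x * P r y|
    · rw [if_pos hc]
      by_cases hxy : x = y
      · rw [if_pos hxy]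
        have : (0 : ℝ) ≤ if B x y ∧ l * nbrDensity B x < 1 ∧ l * nbrDensity B y < 1
          then (1 : ℝ) else 0 := by positivity
        linarith
      · rw [if_neg hxy, if_pos ⟨⟨hxy, hc.2.2⟩, ((hA x).1 hc.1).2, ((hA y).1 hc.2.1).2⟩, zero_add]
    · rw [if_neg hc]
      positivity
  have hd0 : (0 : ℝ) < d := by exact_mod_cast (by omega : 0 < d)
  have hm0 : (0 : ℝ) ≤ m := Nat.cast_nonneg m
  have hninv : (d : ℝ) ^ 2 * (n : ℝ)⁻¹ ≤ 1 := by
    rw [← div_eq_mul_inv]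
    exact div_le_one_of_le₀ hn (Nat.cast_nonneg n)
  -- The halves differ by at most one, so `d² ≤ 4kl + 1`.
  have hkl5 : (d : ℝ) ^ 2 ≤ 5 * (k * l) := by
    have h3 : (3 : ℝ) ≤ d := by exact_mod_cast hd
    have e1 : (d : ℝ) = k + l := by exact_mod_cast hdk
    have e2 : (k : ℝ) ≤ l := by exact_mod_cast hkl
    have e3 : (l : ℝ) ≤ k + 1 := by exact_mod_cast hlk
    nlinarith [mul_nonneg (sub_nonneg.2 e2) (sub_nonneg.2 e3)]
  have hklp : (k * l : ℝ) * p' ≤ 1 / 10 := by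
    have h0 : 0 ≤ (k * l : ℝ) * p' := by positivity
    have h1 : (k * l : ℝ) * p' * (1 - 1 / 50) ≤ 3 * (1 / 50) :=
      (mul_le_mul_of_nonneg_left (by linarith) h0).trans (hedge.trans (by linarith))
    linarith
  have hdp : (d : ℝ) ^ 2 * ((n : ℝ)⁻¹ + p') ≤ 2 := by
    have := mul_le_mul_of_nonneg_right hkl5 hp'0
    linarith
  have hfin : 1 ≤ 100 * (m : ℝ) * ((n : ℝ)⁻¹ + p') :=
    hmain.trans (mul_le_mul_of_nonneg_left hsplit (by positivity))
  calc (d : ℝ) ^ 2 ≤ d ^ 2 * (100 * (m : ℝ) * ((n : ℝ)⁻¹ + p')) :=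
        le_mul_of_one_le_right (by positivity) hfin
    _ = 100 * m * (d ^ 2 * ((n : ℝ)⁻¹ + p')) := by ring
    _ ≤ 100 * m * 2 := by gcongr
    _ = 200 * m := by ring

theorem mainTheorem4 :
    ∃ ε₀ δ₀ c₀ K₀ K₁ : ℝ, 0 < ε₀ ∧ 0 < δ₀ ∧ 0 < c₀ ∧ 0 < K₀ ∧ 0 < K₁ ∧
      ∀ (ε δ : ℝ) (m n d s L : ℕ) [NeZero n] (hL : 1 ≤ L) (P : Matrix (Fin m) (Fin n) ℝ),
        0 < ε → ε < ε₀ → 0 < δ → δ < δ₀ →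
        1 / ε ^ 2 ≤ (d : ℝ) →
        1 ≤ s → (s : ℝ) ≤ 1 / (9 * ε) →
        K₀ * (d : ℝ) ^ 2 / (ε ^ 2 * δ) ≤ (n : ℝ) →
        columnSparsity P ≤ s →
        IsSubspaceEmbedding ε δ P (mixedHardDist n d L hL) →
        c₀ * ((max 1 (Real.logb 2 (s : ℝ))) ^ 4)⁻¹ * (s : ℝ) ^ (-(K₁ * δ)) * (d : ℝ) ^ 2
          ≤ (m : ℝ) := by
  -- `δ₀ = 1/100` makes the doubled failure probability at most `1/50`. Any positive `K₁` would do,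
  -- since `s ≥ 1` makes the power of `s` at most `1`.
  refine ⟨1 / 20, 1 / 100, 1 / 200, 1, 1, by norm_num, by norm_num, by norm_num, by norm_num,
    by norm_num, ?_⟩
  intro ε δ m n d s L _ hL P hε hε' hδ hδ' hd hs hsε hn hsparse hemb
  have hd3 : 3 ≤ d := by
    have h1 : ε ^ 2 ≤ 1 / 3 := by nlinarith
    have h2 : (3 : ℝ) ≤ 1 / ε ^ 2 := by
      rw [le_div_iff₀ (by positivity)]; linarith
    exact_mod_cast h2.trans hd
  have hn' : (d : ℝ) ^ 2 ≤ n := by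
    refine le_trans ?_ hn
    rw [one_mul, le_div_iff₀ (by positivity)]
    have h1 : ε ^ 2 * δ ≤ 1 := mul_le_one₀ (by nlinarith) hδ.le (by linarith)
    exact mul_le_of_le_one_right (by positivity) h1
  have hmain := hemb.hardDist_one.sq_le_rows hε hε' (by linarith) hd3 hs hsε hn' hsparse
  have hlog : ((max 1 (Real.logb 2 (s : ℝ))) ^ 4)⁻¹ ≤ 1 :=
    inv_le_one_of_one_le₀ (one_le_pow₀ (le_max_left _ _))
  have hs1 : (1 : ℝ) ≤ s := by exact_mod_cast hs
  have hpow : (s : ℝ) ^ (-(1 * δ)) ≤ 1 :=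
    Real.rpow_le_one_of_one_le_of_nonpos hs1 (by linarith)
  have hprod : ((max 1 (Real.logb 2 (s : ℝ))) ^ 4)⁻¹ * (s : ℝ) ^ (-(1 * δ)) ≤ 1 :=
    mul_le_one₀ hlog (by positivity) hpow
  have := mul_le_mul_of_nonneg_right hprod (sq_nonneg (d : ℝ))
  linarith
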